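/- A context-free hypergrammar (CFHG) is a tuple $G=\langle\Sigma,X,V,V_0,P,\alpha\rangle$, where $\Sigma$ is a finite alphabet, $X=\{x_1,\dots,x_k\}$ is a finite set of word variables, $\alpha=\mathbb{Q}_1x_1\cdots\mathbb{Q}_kx_k$ with $\mathbb{Q}_i\in\{\exists,\forall\}$ is a quantification condition, and $\hat G=\langle\hat\Sigma,V,V_0,P\rangle$ is a (finite) context-free grammar over the alphabet $\hat\Sigma=(\Sigma\cup\{\#\})^X$, with $\#\notin\Sigma$. It is assumed that every grammar variable and every rule of $\hat G$ derives some terminal word, and that $\hat G$ has no rule $v\to\varepsilon$ with $v\neq V_0$. For $w\in\Sigma^*$ let $w\uparrow_\#$ be the set of all words obtained from $w$ by inserting $\#$-symbols at arbitrary places. For $u:X\to(\Sigma\cup\{\#\})^*$ let $\boldsymbol w_u\in\hat\Sigma^*$ be the word whose $i$-th letter maps each $x\in X$ to the $i$-th letter of $u(x)$, where the shorter words are padded with $\#$ at their end to the length of the longest one. For a language $\mathcal L\subseteq\Sigma^*$ define $\mathcal L\vdash_u(\alpha,\hat G)$ by recursion on $\alpha$: (i) $\mathcal L\vdash_u(\varepsilon,\hat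 G)$ iff $\boldsymbol w_u\in\mathcal L(\hat G)$; (ii) $\mathcal L\vdash_u(\exists x.\alpha',\hat G)$ iff there are $w\in\mathcal L$ and $w_\#\in w\uparrow_\#$ with $\mathcal L\vdash_{u[x\mapsto w_\#]}(\alpha',\hat G)$; (iii) $\mathcal L\vdash_u(\forall x.\alpha',\hat G)$ iff for every $w\in\mathcal L$ there is $w_\#\in w\uparrow_\#$ with $\mathcal L\vdash_{u[x\mapsto w_\#]}(\alpha',\hat G)$. The hyperlanguage $\mathfrak L(G)$ is the set of all nonempty languages $\mathcal L\subseteq\Sigma^*$ with $\mathcal L\vdash_u(\alpha,\hat G)$ (the choice of $u$ is immaterial, since $\alpha$ binds all variables of $X$). The emptiness (nonemptiness) problem for a class of CFHG is to decide, given a CFHG $G$ of the class, whether $\mathfrak L(G)=\emptyset$ (respectively $\mathfrak L(G)\neq\emptyset$). Theorem. The emptiness problem and the nonemptiness problem are undecidable 1. for $\forall^*$-CFHG, that is, for CFHG all of whose quantifiers are $\forall$; and 2. for $\exists\forall$-CFHG, that is, for CFHG with the quantification condition $\exists x_1\forall x_2$. -/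

import Mathlib

namespace HyperGrammar

/-- The two quantifiers that may occur in a quantification condition. -/
inductive Quant where
  | all
  | ex

/-- `Padding w` is the set `w↑#` of all words obtained from `w` by adding `#`-symbols in arbitrary
locations. The symbol `#` is `none`, and `List.reduceOption` removes all its occurrences. -/
def Padding {A : Type} (w : List A) : Set (List (Option A)) :=
  {v | v.reduceOption = w}

/-- The word assignment of `u : X → (Σ ∪ {#})*`, a word over `(Σ ∪ {#})^X`: its `i`-th letter
consists of the `i`-th letters of all the words `u x`, where the shorter words are padded with `#`
at their end up to the length of the longest one. -/
def wordAssignment {A X : Type} [Fintype X] (u : X → List (Option A)) : List (X → Option A) :=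
  (List.range (Finset.univ.sup fun x => (u x).length)).map fun i x => (u x).getD i none

/-- The relation `L ⊢_u (α, Ĝ)`. -/
def Satisfies {A X : Type} [Fintype X] [DecidableEq X] (L : Language A)
    (g : ContextFreeGrammar (X → Option A)) :
    List (Quant × X) → (X → List (Option A)) → Prop
  | [], u => wordAssignment u ∈ g.language
  | (Quant.ex, x) :: α, u =>
      ∃ w ∈ L, ∃ v ∈ Padding w, Satisfies L g α (Function.update u x v)
  | (Quant.all, x) :: α, u =>
      ∀ w ∈ L, ∃ v ∈ Padding w, Satisfies L g α (Function.update u x v)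

/-- Context-free hypergrammars `⟨Σ, X, V, V₀, P, α⟩`, finitely presented. The alphabet `Σ`, the word
variables `X` and the grammar variables `V` are initial segments of the natural numbers, and the
word variables are numbered in the order in which the quantification condition binds them. -/
structure CFHG where
  /-- the number of letters of `Σ` -/
  numLetters : ℕ
  /-- the number of word variables -/
  numWordVars : ℕ
  /-- the number of grammar variables -/
  numVars : ℕ
  /-- the initial grammar variable -/
  start : Fin numVars
  /-- the grammar rules, over the alphabet `(Σ ∪ {#})^X` -/
  rules : List (ContextFreeRule (Fin numWordVars → Option (Fin numLetters)) (Fin numVars))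
  /-- the quantifier that binds each word variable -/
  quant : Fin numWordVars → Quant

namespace CFHG

/-- The underlying context-free grammar `Ĝ`. -/
def underlying (G : CFHG) :
    ContextFreeGrammar (Fin G.numWordVars → Option (Fin G.numLetters)) where
  NT := Fin G.numVars
  initial := G.start
  rules := G.rules.toFinset

/-- The quantification condition `α = Q₁ x₁ ⋯ Qₖ xₖ`. -/
def condition (G : CFHG) : List (Quant × Fin G.numWordVars) :=
  List.ofFn fun i => (G.quant i, i)

/-- The hyperlanguage of `G`: the nonempty languages that `G` derives. As `α` binds every word
variable, the initial assignment is immaterial. -/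
def hyperlanguage (G : CFHG) : Set (Language (Fin G.numLetters)) :=
  {L | Set.Nonempty (L : Set (List (Fin G.numLetters))) ∧
    Satisfies L G.underlying G.condition fun _ => []}

/-- The standing assumptions on the underlying grammar: every grammar variable and the right-hand
side of every rule derives some terminal word, and only the initial variable may have an
`ε`-rule. -/
structure Normalized (G : CFHG) : Prop where
  var_productive : ∀ v : Fin G.numVars, ∃ w : List (Fin G.numWordVars → Option (Fin G.numLetters)),
    G.underlying.Derives [Symbol.nonterminal v] (w.map Symbol.terminal)
  rule_productive : ∀ r ∈ G.rules, ∃ w : List (Fin G.numWordVars → Option (Fin G.numLetters)),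
    G.underlying.Derives r.output (w.map Symbol.terminal)
  eps_free : ∀ r ∈ G.rules, r.output = [] → r.input = G.start

/-- `∀*`-CFHG. -/
def IsForallStar (G : CFHG) : Prop := ∀ i, G.quant i = Quant.all

/-- `∃∀`-CFHG. -/
def IsExistsForall (G : CFHG) : Prop := List.ofFn G.quant = [Quant.ex, Quant.all]

/-- The input data of an algorithm on CFHG: the numbers of letters and of grammar variables, the
initial variable, the sequence of quantifiers (`true` for `∀`), and the list of rules. -/
abbrev Code : Type :=
  ℕ × ℕ × ℕ × List Bool × List (ℕ × List (List (Option ℕ) ⊕ ℕ))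

/-- A letter of `(Σ ∪ {#})^X` is written as the list of its values, a grammar variable as its
number. -/
def encodeSymbol {s k n : ℕ} : Symbol (Fin k → Option (Fin s)) (Fin n) → List (Option ℕ) ⊕ ℕ
  | Symbol.terminal a => Sum.inl (List.ofFn fun x => (a x).map Fin.val)
  | Symbol.nonterminal v => Sum.inr v.val

/-- The left-hand side of a rule and the symbols of its right-hand side. -/
def encodeRule {s k n : ℕ} (r : ContextFreeRule (Fin k → Option (Fin s)) (Fin n)) :
    ℕ × List (List (Option ℕ) ⊕ ℕ) :=
  (r.input.val, r.output.map encodeSymbol)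

/-- The truth value that stands for a quantifier. -/
def encodeQuant : Quant → Bool
  | Quant.all => true
  | Quant.ex => false

/-- The finite description of a CFHG that is given to an algorithm. -/
def encode (G : CFHG) : Code :=
  (G.numLetters, G.numVars, G.start.val, List.ofFn fun i => encodeQuant (G.quant i),
    G.rules.map encodeRule)

theorem encodeSymbol_injective {s k n : ℕ} :
    Function.Injective (encodeSymbol (s := s) (k := k) (n := n)) := by
  rintro (a | v) (b | w) h
  · have h1 := List.ofFn_injective (Sum.inl.inj h)
    congr 1
    funext x
    exact Option.map_injective Fin.val_injective (congrFun h1 x)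
  · exact absurd h (by simp [encodeSymbol])
  · exact absurd h (by simp [encodeSymbol])
  · congr 1
    exact Fin.val_injective (Sum.inr.inj h)

theorem encodeRule_injective {s k n : ℕ} :
    Function.Injective (encodeRule (s := s) (k := k) (n := n)) := by
  intro r r' h
  have h' := Prod.mk.inj h
  exact ContextFreeRule.ext (Fin.val_injective h'.1)
    (List.map_injective_iff.mpr encodeSymbol_injective h'.2)

/-- A CFHG is determined by its description. -/
theorem encode_injective : Function.Injective encode := by
  rintro ⟨s, k, n, v, P, q⟩ ⟨s', k', n', v', P', q'⟩ h
  simp only [encode, Prod.mk.injEq] at h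
  obtain ⟨rfl, rfl, hv, hq, hP⟩ := h
  obtain rfl : k = k' := by simpa using congrArg List.length hq
  obtain rfl : v = v' := Fin.val_injective hv
  obtain rfl : P = P' := List.map_injective_iff.mpr encodeRule_injective hP
  obtain rfl : q = q' := by
    funext i
    have hi := congrFun (List.ofFn_injective hq) i
    generalize q i = a at hi
    generalize q' i = b at hi
    cases a <;> cases b <;> simp_all [encodeQuant]
  rfl

/-- The problem "given a CFHG of the class `C`, does it have the property `Q`?" is undecidable: no
computable function answers it correctly on the descriptions of all members of `C`. -/
def Undecidable (C Q : CFHG → Prop) : Prop :=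
  ¬ ∃ f : Code → Bool, Computable f ∧ ∀ G : CFHG, C G → (f G.encode = true ↔ Q G)

end CFHG

end HyperGrammar

/-! The halting problem reduces to nonemptiness, uniformly in the first of two quantifiers;
emptiness is the complement. If the second of two word variables is universal, any witness `L`
yields one word read by both variables, and a singleton suffices conversely. So nonemptiness asks
whether the grammar derives a word whose two tracks agree after the deletion of `#`
(`exists_satisfies_iff`).

Such an equality can force a computation, as in Post's correspondence problem. The second track
writes the initial configuration; from then on, the first track reads a configuration while the
second writes its successor, and a final configuration is read without writing anything. If the
tracks agree, every configuration read is the one written before, so the word is a halting run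
(`exists_equal_tracks_iff`). The free insertion of `#` is what allows one track to lag behind the
other.

The machines are multi-stack machines. A configuration lists a state and one shuffle of all stacks,
so the top of stack `k` is the first letter tagged `k`, and a move copies everything before it and
after it. Mathlib's `TM2` program for a partial recursive code is such a machine once each stack has
a bottom letter (`stackHalts_iff_eval_dom`). One fixed code simulates program `m` on input 0 when
given `2 ^ m`; in binary this is `m` zeros and a one, so only one rule of the grammar depends on
`m`, in an evidently computable way. -/

namespace HyperGrammar

/-! ### Two-track words and singleton witnesses -/

/-- The word that is read in the coordinate `x` of a word over `(Σ ∪ {#})^X`. -/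
def track {A X : Type} (x : X) (w : List (X → Option A)) : List A :=
  (w.map fun a => a x).reduceOption

theorem track_append {A X : Type} (x : X) (v w : List (X → Option A)) :
    track x (v ++ w) = track x v ++ track x w := by
  simp [track, List.reduceOption_append]

theorem track_wordAssignment {A X : Type} [Fintype X] (u : X → List (Option A)) (x : X) :
    track x (wordAssignment u) = (u x).reduceOption := by
  -- Reading beyond the end of a word yields `none`, so the padding is a block of `none` that
  -- `reduceOption` deletes.
  have key : ∀ (l : List (Option A)) (n : ℕ), l.length ≤ n →
      (List.range n).map (fun i => l.getD i none) = l ++ List.replicate (n - l.length) none := by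
    intro l n h
    apply List.ext_getElem
    · simp; omega
    · intro i h₁ h₂
      by_cases hi : i < l.length
      · simp [List.getElem_append_left, hi]
      · rw [List.getElem_append_right (not_lt.mp hi)]
        simp [hi]
  have h := key (u x) _ (Finset.le_sup (f := fun x => (u x).length) (Finset.mem_univ x))
  simp only [track, wordAssignment, List.map_map]
  rw [show ((fun a : X → Option A => a x) ∘ fun i x => (u x).getD i none) =
    fun i => (u x).getD i none from rfl, h, List.reduceOption_append,
    List.reduceOption_replicate_none, List.append_nil]

theorem wordAssignment_coordinates {A X : Type} [Fintype X] [Nonempty X]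
    (w : List (X → Option A)) : wordAssignment (fun x => w.map fun a => a x) = w := by
  have h : (Finset.univ.sup fun _ : X => w.length) = w.length :=
    Finset.sup_const Finset.univ_nonempty _
  simp only [wordAssignment, List.length_map, h]
  apply List.ext_getElem
  · simp
  · intro i h₁ h₂
    funext x
    simp [h₂]

/-- If the second of two word variables is universal, nonemptiness is witnessed by singletons. -/
theorem exists_satisfies_iff {A : Type} (g : ContextFreeGrammar (Fin 2 → Option A)) (q : Quant) :
    (∃ L : Language A, Set.Nonempty (L : Set (List A)) ∧
      Satisfies L g [(q, 0), (Quant.all, 1)] fun _ => []) ↔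
      ∃ w ∈ g.language, track 0 w = track 1 w := by
  constructor
  · rintro ⟨L, ⟨w, hw⟩, hL⟩
    -- Nonemptiness of `L` turns a leading `∀` into an `∃`; the universal second variable is then
    -- instantiated with the same word.
    have key : ∃ w ∈ L, ∃ v ∈ Padding w, Satisfies L g [(Quant.all, 1)]
        (Function.update (fun _ => []) 0 v) := by
      cases q with
      | all => exact ⟨w, hw, hL w hw⟩
      | ex => exact hL
    obtain ⟨w, hw, v, hv, h⟩ := key
    obtain ⟨v', hv', h'⟩ := h w hw
    refine ⟨_, h', ?_⟩
    rw [track_wordAssignment, track_wordAssignment]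
    simpa using Eq.trans hv hv'.symm
  · rintro ⟨w, hw, h⟩
    have key : ∃ v ∈ Padding (track 0 w), Satisfies {track 0 w} g
        [(Quant.all, 1)] (Function.update (fun _ => []) 0 v) := by
      refine ⟨w.map fun a : Fin 2 → Option A => a 0, rfl, ?_⟩
      rintro _ rfl
      refine ⟨w.map fun a : Fin 2 → Option A => a 1, h.symm, ?_⟩
      have e : Function.update (Function.update (fun _ => []) (0 : Fin 2) (w.map fun a => a 0)) 1
          (w.map fun a => a 1) = fun x => w.map fun a => a x := by
        funext x
        fin_cases x <;> simp
      rw [e, Satisfies, wordAssignment_coordinates]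
      exact hw
    refine ⟨{track 0 w}, ⟨_, rfl⟩, ?_⟩
    cases q with
    | all =>
      rintro _ rfl
      exact key
    | ex => exact ⟨_, rfl, key⟩

/-- The hypergrammar with two word variables, the second of which is bound by `∀`. -/
def twoVarCFHG {s n : ℕ} (q : Quant) (start : Fin n)
    (rules : List (ContextFreeRule (Fin 2 → Option (Fin s)) (Fin n))) : CFHG where
  numLetters := s
  numWordVars := 2
  numVars := n
  start := start
  rules := rules
  quant := ![q, Quant.all]

/-- The context-free grammar of `twoVarCFHG`. -/
def twoVarGrammar {s n : ℕ} (start : Fin n)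
    (rules : List (ContextFreeRule (Fin 2 → Option (Fin s)) (Fin n))) :
    ContextFreeGrammar (Fin 2 → Option (Fin s)) where
  NT := Fin n
  initial := start
  rules := rules.toFinset

theorem twoVarCFHG_hyperlanguage_nonempty_iff {s n : ℕ} (q : Quant) (start : Fin n)
    (rules : List (ContextFreeRule (Fin 2 → Option (Fin s)) (Fin n))) :
    (twoVarCFHG q start rules).hyperlanguage.Nonempty ↔
      ∃ w ∈ (twoVarGrammar start rules).language, track 0 w = track 1 w :=
  exists_satisfies_iff (twoVarGrammar start rules) q

/-! ### Languages closed under the rules of a grammar -/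

/-- The language of a symbol, given languages for the nonterminals. -/
def symbolLanguage {T N : Type} (I : N → Language T) : Symbol T N → Language T
  | Symbol.terminal t => {[t]}
  | Symbol.nonterminal v => I v

/-- The language of a sentential form, given languages for the nonterminals. -/
def formLanguage {T N : Type} (I : N → Language T) (u : List (Symbol T N)) : Language T :=
  (u.map (symbolLanguage I)).prod

section FormLanguage

variable {T N : Type} (I : N → Language T)

theorem formLanguage_append (u v : List (Symbol T N)) :
    formLanguage I (u ++ v) = formLanguage I u * formLanguage I v := by
  simp [formLanguage]

theorem formLanguage_nonterminal (v : N) :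
    formLanguage I [Symbol.nonterminal v] = I v := by
  simp [formLanguage, symbolLanguage]

theorem formLanguage_terminals (w : List T) :
    formLanguage I (w.map Symbol.terminal) = {w} := by
  induction w with
  | nil => rfl
  | cons t w ih =>
    change {[t]} * formLanguage I (w.map Symbol.terminal) = _
    rw [ih]
    exact Set.image2_singleton

/-- Languages that are closed under the rules contain all derived words. -/
theorem mem_of_derives {T : Type} {g : ContextFreeGrammar T} {I : g.NT → Language T}
    (hI : ∀ r ∈ g.rules, formLanguage I r.output ≤ I r.input) {v : g.NT} {w : List T}
    (h : g.Derives [Symbol.nonterminal v] (w.map Symbol.terminal)) : w ∈ I v := by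
  -- Over all sentential forms: a rewriting step can only shrink the language, since concatenation
  -- is monotone.
  have key : ∀ {u u'}, g.Derives u u' → formLanguage I u' ≤ formLanguage I u := by
    intro u u' h
    induction h with
    | refl => exact le_rfl
    | tail _ h ih =>
      refine le_trans ?_ ih
      obtain ⟨r, hr, h⟩ := h
      obtain ⟨p, q, rfl, rfl⟩ := h.exists_parts
      simp only [formLanguage_append, formLanguage_nonterminal]
      gcongr
      exact hI r hr
  have h' := key h
  rw [formLanguage_terminals, formLanguage_nonterminal] at h'
  exact h' rfl

end FormLanguage

theorem derives_of_mem_rules {T : Type} {g : ContextFreeGrammar T} {r : ContextFreeRule T g.NT}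
    (hr : r ∈ g.rules) : g.Derives [Symbol.nonterminal r.input] r.output :=
  ContextFreeGrammar.Produces.single ⟨r, hr, ContextFreeRule.Rewrites.input_output⟩

theorem derives_append {T : Type} {g : ContextFreeGrammar T} {u u' v v' : List (Symbol T g.NT)}
    (h : g.Derives u u') (h' : g.Derives v v') : g.Derives (u ++ v) (u' ++ v') :=
  (h.append_right v).trans (h'.append_left u')

/-! ### Stack machines and shuffles of stacks -/

/-- A nondeterministic machine with stacks indexed by `K` reaches a state in `F`. In a move
`R q k l r q'` the machine passes from `q` to `q'` and replaces `l` by `r` at the top of the stack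
`k`. -/
inductive StackHalts {Q K Γ : Type} [DecidableEq K]
    (R : Q → K → Option Γ → Option Γ → Q → Prop) (F : Q → Prop) : Q → (K → List Γ) → Prop
  | final {q : Q} {S : K → List Γ} : F q → StackHalts R F q S
  | move {q q' : Q} {S : K → List Γ} {k : K} {l r : Option Γ} {t : List Γ} :
      R q k l r q' → S k = l.toList ++ t →
      StackHalts R F q' (Function.update S k (r.toList ++ t)) → StackHalts R F q S

section StackOf

variable {K Γ : Type} [DecidableEq K]

/-- The stack `k` of a shuffle of stacks, with the top in front. -/
def stackOf (z : List (K × Γ)) (k : K) : List Γ :=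
  (z.filter fun b => b.1 = k).map Prod.snd

theorem stackOf_append (x y : List (K × Γ)) (k : K) :
    stackOf (x ++ y) k = stackOf x k ++ stackOf y k := by
  simp [stackOf]

theorem stackOf_eq_nil {x : List (K × Γ)} {k : K} (h : ∀ b ∈ x, b.1 ≠ k) : stackOf x k = [] := by
  simpa [stackOf] using fun a b hb hk => h (a, b) hb hk

theorem stackOf_map_mk (k : K) (l : List Γ) : stackOf (l.map (Prod.mk k)) k = l := by
  simp [stackOf, List.filter_map, Function.comp_def]

theorem stackOf_map_mk_of_ne {k k' : K} (h : k' ≠ k) (l : List Γ) :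
    stackOf (l.map (Prod.mk k)) k' = [] :=
  stackOf_eq_nil (by simpa using fun _ _ => h.symm)

/-- With no letter of stack `k` in `x`, the block behind `x` is the top of that stack, while the
order of the other stacks' letters is unaffected. -/
theorem stackOf_replace {x : List (K × Γ)} {k : K} (hx : ∀ b ∈ x, b.1 ≠ k) (l r : List Γ)
    (y : List (K × Γ)) :
    stackOf (x ++ r.map (Prod.mk k) ++ y) =
      Function.update (stackOf (x ++ l.map (Prod.mk k) ++ y)) k (r ++ stackOf y k) := by
  funext k'
  by_cases h : k' = k
  · subst h
    simp [stackOf_append, stackOf_eq_nil hx, stackOf_map_mk]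
  · simp [stackOf_append, stackOf_map_mk_of_ne h, h]

/-- The split is made at the first letter tagged `k`; if nothing is to be removed, the front of the
shuffle serves. -/
theorem exists_split_of_stackOf_eq {k : K} (l : Option Γ) {t : List Γ} (z : List (K × Γ))
    (h : stackOf z k = l.toList ++ t) :
    ∃ x y, z = x ++ l.toList.map (Prod.mk k) ++ y ∧ (∀ b ∈ x, b.1 ≠ k) ∧ stackOf y k = t := by
  cases l with
  | none => exact ⟨[], z, by simp, by simp, by simpa using h⟩
  | some a =>
    induction z with
    | nil => simp [stackOf] at h
    | cons b z ih =>
      obtain ⟨k', g⟩ := b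
      by_cases hk : k' = k
      · subst hk
        have h' : g = a ∧ stackOf z k' = t := by simpa [stackOf] using h
        exact ⟨[], z, by simp [h'.1], by simp, h'.2⟩
      · have h' : stackOf z k = (some a).toList ++ t := by
          rw [← h]
          simp [stackOf, hk]
        obtain ⟨x, y, rfl, hx, hy⟩ := ih h'
        exact ⟨(k', g) :: x, y, by simp, by simpa [hk] using hx, hy⟩

end StackOf

/-! ### The grammar of runs -/

/-- The grammar variables of the grammar that describes the runs of a stack machine. -/
inductive RunVar (K : Type)
  | start
  | run
  | erase
  | copy (avoid : Option K)

instance {K : Type} [Fintype K] : Fintype (RunVar K) :=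
  Fintype.ofEquiv (Fin 3 ⊕ Option K)
    { toFun := Sum.elim ![.start, .run, .erase] .copy
      invFun := fun v => match v with
        | .start => .inl 0
        | .run => .inl 1
        | .erase => .inl 2
        | .copy o => .inr o
      left_inv := by
        rintro (i | o)
        · fin_cases i <;> rfl
        · rfl
      right_inv := by rintro (_ | _ | _ | o) <;> rfl }

/-- The letters of the runs of a stack machine: `none` ends a configuration. -/
abbrev RunLetter (Q K Γ : Type) : Type := Option (Q ⊕ K × Γ)

section Runs

variable {Q K Γ : Type}

/-- The letters of a shuffle of stacks. -/
def stackWord (z : List (K × Γ)) : List (RunLetter Q K Γ) :=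
  z.map fun b => some (Sum.inr b)

/-- The word that describes a configuration. -/
def configWord (q : Q) (z : List (K × Γ)) : List (RunLetter Q K Γ) :=
  some (Sum.inl q) :: stackWord z ++ [none]

theorem stackWord_append (x y : List (K × Γ)) :
    (stackWord (x ++ y) : List (RunLetter Q K Γ)) = stackWord x ++ stackWord y := by
  simp [stackWord]

/-- Letters of a stack word are never `none`, so the first `none` marks its end. -/
theorem stackWord_append_none_inj {x y : List (K × Γ)} {u v : List (RunLetter Q K Γ)}
    (h : stackWord x ++ none :: u = stackWord y ++ none :: v) : x = y ∧ u = v := by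
  induction x generalizing y with
  | nil =>
    cases y with
    | nil => simpa [stackWord] using h
    | cons b y => simp [stackWord] at h
  | cons a x ih =>
    cases y with
    | nil => simp [stackWord] at h
    | cons b y =>
      have h' : a = b ∧ stackWord x ++ none :: u = stackWord y ++ none :: v := by
        simpa [stackWord] using h
      obtain ⟨rfl, rfl⟩ := ih h'.2
      exact ⟨by rw [h'.1], rfl⟩

variable {s n : ℕ} (φ : RunLetter Q K Γ ≃ Fin s) (ψ : RunVar K ≃ Fin n)

/-- The word with `l` in the first and `r` in the second coordinate. -/
def tile (l r : List (RunLetter Q K Γ)) : List (Fin 2 → Option (Fin s)) :=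
  l.map (fun a => ![some (φ a), none]) ++ r.map (fun a => ![none, some (φ a)])

/-- The word over the letters of the runs that is read in a coordinate. -/
def runTrack (i : Fin 2) (w : List (Fin 2 → Option (Fin s))) : List (RunLetter Q K Γ) :=
  (track i w).map φ.symm

theorem runTrack_append (i : Fin 2) (v w : List (Fin 2 → Option (Fin s))) :
    runTrack φ i (v ++ w) = runTrack φ i v ++ runTrack φ i w := by
  simp [runTrack, track_append]

theorem track_tile_zero (l r : List (RunLetter Q K Γ)) : track 0 (tile φ l r) = l.map φ := by
  simp only [track, tile, List.map_append, List.map_map, List.reduceOption_append]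
  induction l with
  | nil => induction r <;> simp_all [Function.comp_def]
  | cons a l ih => simpa [Function.comp_def] using ih

theorem track_tile_one (l r : List (RunLetter Q K Γ)) : track 1 (tile φ l r) = r.map φ := by
  simp only [track, tile, List.map_append, List.map_map, List.reduceOption_append]
  induction l with
  | nil => induction r <;> simp_all [Function.comp_def]
  | cons a l ih => simpa [Function.comp_def] using ih

@[simp]
theorem runTrack_tile_zero (l r : List (RunLetter Q K Γ)) : runTrack φ 0 (tile φ l r) = l := by
  simp [runTrack, track_tile_zero]

@[simp]
theorem runTrack_tile_one (l r : List (RunLetter Q K Γ)) : runTrack φ 1 (tile φ l r) = r := by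
  simp [runTrack, track_tile_one]

/-- A one-letter word that is empty in both coordinates. -/
def blank : List (Fin 2 → Option (Fin s)) := [fun _ => none]

@[simp]
theorem runTrack_blank (i : Fin 2) : runTrack φ i blank = [] := by
  simp [runTrack, track, blank, List.reduceOption]

/-- The sentential form of a terminal word. -/
abbrev terminals (w : List (Fin 2 → Option (Fin s))) :
    List (Symbol (Fin 2 → Option (Fin s)) (Fin n)) :=
  w.map Symbol.terminal

/-- The sentential form of a grammar variable. -/
abbrev variableForm (v : RunVar K) : List (Symbol (Fin 2 → Option (Fin s)) (Fin n)) :=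
  [Symbol.nonterminal (ψ v)]

open RunVar

/-- The second coordinate writes the initial configuration. -/
def startRule (q : Q) (z : List (K × Γ)) : ContextFreeRule (Fin 2 → Option (Fin s)) (Fin n) :=
  ⟨ψ start, terminals (tile φ [] (configWord q z)) ++ variableForm ψ run⟩

/-- The first coordinate reads a configuration, and the second one writes its successor. -/
def moveRule (q : Q) (k : K) (l r : Option Γ) (q' : Q) :
    ContextFreeRule (Fin 2 → Option (Fin s)) (Fin n) :=
  ⟨ψ run, terminals (tile φ [some (Sum.inl q)] [some (Sum.inl q')]) ++
    (variableForm ψ (copy (some k)) ++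
    (terminals (tile φ (stackWord (l.toList.map (Prod.mk k)))
      (stackWord (r.toList.map (Prod.mk k)))) ++
    (variableForm ψ (copy none) ++ (terminals (tile φ [none] [none]) ++ variableForm ψ run))))⟩

/-- The first coordinate reads a final configuration. -/
def finalRule (q : Q) : ContextFreeRule (Fin 2 → Option (Fin s)) (Fin n) :=
  ⟨ψ run, terminals (tile φ [some (Sum.inl q)] []) ++
    (variableForm ψ erase ++ terminals (tile φ [none] []))⟩

/-- A rule without use for words with equal coordinates, which makes all variables productive. -/
def abortRule : ContextFreeRule (Fin 2 → Option (Fin s)) (Fin n) :=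
  ⟨ψ run, terminals (tile φ [] [none])⟩

/-- Copying ends. -/
def copyNilRule (o : Option K) : ContextFreeRule (Fin 2 → Option (Fin s)) (Fin n) :=
  ⟨ψ (copy o), terminals blank⟩

/-- A stack letter is copied. -/
def copyConsRule (o : Option K) (b : K × Γ) : ContextFreeRule (Fin 2 → Option (Fin s)) (Fin n) :=
  ⟨ψ (copy o), terminals (tile φ (stackWord [b]) (stackWord [b])) ++ variableForm ψ (copy o)⟩

/-- Erasing ends. -/
def eraseNilRule : ContextFreeRule (Fin 2 → Option (Fin s)) (Fin n) :=
  ⟨ψ erase, terminals blank⟩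

/-- A stack letter is erased. -/
def eraseConsRule (b : K × Γ) : ContextFreeRule (Fin 2 → Option (Fin s)) (Fin n) :=
  ⟨ψ erase, terminals (tile φ (stackWord [b]) []) ++ variableForm ψ erase⟩

variable (R : Q → K → Option Γ → Option Γ → Q → Prop) (F : Q → Prop)

/-- The classification of the rules that do not depend on the initial configuration. -/
inductive IsRunRule : ContextFreeRule (Fin 2 → Option (Fin s)) (Fin n) → Prop
  | move {q k l r q'} : R q k l r q' → IsRunRule (moveRule φ ψ q k l r q')
  | final {q} : F q → IsRunRule (finalRule φ ψ q)
  | abort : IsRunRule (abortRule φ ψ)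
  | copyNil (o) : IsRunRule (copyNilRule ψ o)
  | copyCons {o b} : some b.1 ≠ o → IsRunRule (copyConsRule φ ψ o b)
  | eraseNil : IsRunRule (eraseNilRule ψ)
  | eraseCons (b) : IsRunRule (eraseConsRule φ ψ b)

/-! ### Soundness: equal tracks give a halting run -/

section Soundness

variable [DecidableEq K]

/-- The meaning of the grammar variables. -/
def runMeaning (q₀ : Q) (z₀ : List (K × Γ)) : RunVar K → Language (Fin 2 → Option (Fin s))
  | start => {w | runTrack φ 0 w = runTrack φ 1 w → StackHalts R F q₀ (stackOf z₀)}
  | run => {w | ∀ q z, runTrack φ 0 w = configWord q z ++ runTrack φ 1 w →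
      StackHalts R F q (stackOf z)}
  | erase => {w | ∃ x, runTrack φ 0 w = stackWord x ∧ runTrack φ 1 w = []}
  | copy o => {w | ∃ x, (∀ b ∈ x, some b.1 ≠ o) ∧ runTrack φ 0 w = stackWord x ∧
      runTrack φ 1 w = stackWord x}

/-- The invariant for `run` says that the second track is one configuration ahead. A move rule lets
the first track consume this configuration and the second write the next one, so the same lag
remains for the rest of the word. -/
theorem runMeaning_closed (q₀ : Q) (z₀ : List (K × Γ))
    {r : ContextFreeRule (Fin 2 → Option (Fin s)) (Fin n)}
    (hr : r = startRule φ ψ q₀ z₀ ∨ IsRunRule φ ψ R F r) :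
    formLanguage (fun v => runMeaning φ R F q₀ z₀ (ψ.symm v)) r.output ≤
      runMeaning φ R F q₀ z₀ (ψ.symm r.input) := by
  rcases hr with rfl | (hR | hF | _ | o | hb | _ | b)
  · simp only [startRule, formLanguage_append, formLanguage_nonterminal, formLanguage_terminals,
      Equiv.symm_apply_apply]
    rintro _ ⟨_, rfl, w, hw, rfl⟩ h
    refine hw q₀ z₀ ?_
    simpa [runTrack_append] using h
  · rename_i q k l r q'
    simp only [moveRule, formLanguage_append, formLanguage_nonterminal, formLanguage_terminals,
      Equiv.symm_apply_apply]
    rintro _ ⟨_, rfl, _, ⟨u, ⟨x, hx, hu₀, hu₁⟩, _, ⟨_, rfl, _, ⟨v, ⟨y, -, hv₀, hv₁⟩, _,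
      ⟨_, rfl, w, hw, rfl⟩, rfl⟩, rfl⟩, rfl⟩, rfl⟩ p z h
    simp only [runTrack_append, runTrack_tile_zero, runTrack_tile_one, hu₀, hu₁, hv₀, hv₁,
      configWord, List.cons_append, List.nil_append, List.cons.injEq, Option.some.injEq,
      Sum.inl.injEq, List.append_assoc] at h
    obtain ⟨rfl, h⟩ := h
    -- With the states matched, both sides are cut at their first `none`: this identifies the
    -- guessed split with the actual shuffle and leaves the invariant for the remaining word.
    have h' : stackWord (x ++ l.toList.map (Prod.mk k) ++ y) ++ none :: runTrack φ 0 w =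
        stackWord z ++ none :: (configWord q' (x ++ r.toList.map (Prod.mk k) ++ y) ++
          runTrack φ 1 w) := by
      simpa [stackWord_append, configWord] using h
    obtain ⟨rfl, hw'⟩ := stackWord_append_none_inj h'
    have hx' : ∀ b ∈ x, b.1 ≠ k := fun b hb => by simpa using hx b hb
    refine StackHalts.move hR (t := stackOf y k) ?_ ?_
    · simp [stackOf_append, stackOf_eq_nil hx', stackOf_map_mk]
    · rw [← stackOf_replace hx']
      exact hw _ _ hw'
  · simp only [finalRule, formLanguage_append, formLanguage_nonterminal, formLanguage_terminals,
      Equiv.symm_apply_apply]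
    rintro _ ⟨_, rfl, _, ⟨u, ⟨x, hu₀, hu₁⟩, _, rfl, rfl⟩, rfl⟩ p z h
    simp only [runTrack_append, runTrack_tile_zero, configWord, List.cons_append,
      List.nil_append, List.cons.injEq, Option.some.injEq, Sum.inl.injEq] at h
    rw [← h.1]
    exact StackHalts.final hF
  -- The first track is empty here and cannot begin with a configuration, so the invariant is
  -- vacuous.
  · simp only [abortRule, formLanguage_terminals, Equiv.symm_apply_apply]
    rintro _ rfl p z h
    simp [configWord] at h
  · simp only [copyNilRule, formLanguage_terminals, Equiv.symm_apply_apply]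
    rintro _ rfl
    exact ⟨[], by simp, by simp [stackWord], by simp [stackWord]⟩
  · rename_i o b
    simp only [copyConsRule, formLanguage_append, formLanguage_nonterminal,
      formLanguage_terminals, Equiv.symm_apply_apply]
    rintro _ ⟨_, rfl, w, ⟨x, hx, h₀, h₁⟩, rfl⟩
    exact ⟨b :: x, by simpa using ⟨hb, fun k g h => hx (k, g) h⟩,
      by simp [runTrack_append, h₀, stackWord], by simp [runTrack_append, h₁, stackWord]⟩
  · simp only [eraseNilRule, formLanguage_terminals, Equiv.symm_apply_apply]
    rintro _ rfl
    exact ⟨[], by simp [stackWord], by simp⟩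
  · simp only [eraseConsRule, formLanguage_append, formLanguage_nonterminal,
      formLanguage_terminals, Equiv.symm_apply_apply]
    rintro _ ⟨_, rfl, w, ⟨x, h₀, h₁⟩, rfl⟩
    exact ⟨b :: x, by simp [runTrack_append, h₀, stackWord], by simp [runTrack_append, h₁]⟩

end Soundness

variable [Fintype Q] [Fintype K] [Fintype Γ]

open scoped Classical in
/-- The rules that do not depend on the initial configuration. -/
noncomputable def runRules :
    List (ContextFreeRule (Fin 2 → Option (Fin s)) (Fin n)) :=
  (Finset.univ.filter fun p : Q × K × Option Γ × Option Γ × Q =>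
      R p.1 p.2.1 p.2.2.1 p.2.2.2.1 p.2.2.2.2).toList.map
    (fun p => moveRule φ ψ p.1 p.2.1 p.2.2.1 p.2.2.2.1 p.2.2.2.2) ++
  ((Finset.univ.filter F).toList.map (finalRule φ ψ) ++
  (abortRule φ ψ :: (Finset.univ.toList.map (copyNilRule ψ) ++
  ((Finset.univ.filter fun p : Option K × K × Γ => some p.2.1 ≠ p.1).toList.map
    (fun p => copyConsRule φ ψ p.1 p.2) ++
  (eraseNilRule ψ :: Finset.univ.toList.map (eraseConsRule φ ψ))))))

theorem mem_runRules {r : ContextFreeRule (Fin 2 → Option (Fin s)) (Fin n)} :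
    r ∈ runRules φ ψ R F ↔ IsRunRule φ ψ R F r := by
  simp only [runRules, List.mem_append, List.mem_map, List.mem_cons, Finset.mem_toList,
    Finset.mem_filter, Finset.mem_univ, true_and]
  constructor
  · rintro (⟨p, h, rfl⟩ | ⟨q, h, rfl⟩ | rfl | ⟨o, rfl⟩ | ⟨p, h, rfl⟩ | rfl | ⟨b, rfl⟩)
    exacts [.move h, .final h, .abort, .copyNil _, .copyCons h, .eraseNil, .eraseCons _]
  · rintro (h | h | _ | _ | h | _ | _)
    · exact Or.inl ⟨(_, _, _, _, _), h, rfl⟩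
    · exact Or.inr (Or.inl ⟨_, h, rfl⟩)
    · tauto
    · tauto
    · exact Or.inr (Or.inr (Or.inr (Or.inr (Or.inl ⟨(_, _), h, rfl⟩))))
    · tauto
    · tauto

/-- The grammar that describes the runs from a given configuration. -/
noncomputable abbrev runGrammar (q : Q) (z : List (K × Γ)) :
    ContextFreeGrammar (Fin 2 → Option (Fin s)) :=
  twoVarGrammar (ψ start) (startRule φ ψ q z :: runRules φ ψ R F)

theorem mem_rules_runGrammar {q : Q} {z : List (K × Γ)}
    {r : ContextFreeRule (Fin 2 → Option (Fin s)) (Fin n)} :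
    r ∈ (runGrammar φ ψ R F q z).rules ↔ r = startRule φ ψ q z ∨ IsRunRule φ ψ R F r := by
  change r ∈ (startRule φ ψ q z :: runRules φ ψ R F).toFinset ↔ _
  rw [List.mem_toFinset, List.mem_cons, mem_runRules]

variable {R F}

/-! ### Completeness: halting runs give words with equal tracks -/

section Completeness

variable {q₀ : Q} {z₀ : List (K × Γ)}

/-- A variable of the grammar of the runs derives a terminal word. -/
abbrev RunDerives (R : Q → K → Option Γ → Option Γ → Q → Prop) (F : Q → Prop) (q₀ : Q)
    (z₀ : List (K × Γ)) (v : RunVar K) (w : List (Fin 2 → Option (Fin s))) : Prop :=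
  (runGrammar φ ψ R F q₀ z₀).Derives (variableForm ψ v) (terminals w)

theorem exists_runDerives_copy (o : Option K) (x : List (K × Γ)) (hx : ∀ b ∈ x, some b.1 ≠ o) :
    ∃ w, RunDerives φ ψ R F q₀ z₀ (copy o) w ∧ runTrack φ 0 w = stackWord x ∧
      runTrack φ 1 w = stackWord x := by
  induction x with
  | nil =>
    exact ⟨blank, derives_of_mem_rules ((mem_rules_runGrammar ..).2 (.inr (.copyNil o))),
      by simp [stackWord], by simp [stackWord]⟩
  | cons b x ih =>
    obtain ⟨w, hw, h₀, h₁⟩ := ih fun b hb => hx b (List.mem_cons_of_mem _ hb)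
    refine ⟨tile φ (stackWord [b]) (stackWord [b]) ++ w, ?_,
      by simp [runTrack_append, h₀, stackWord], by simp [runTrack_append, h₁, stackWord]⟩
    have hr := derives_of_mem_rules ((mem_rules_runGrammar φ ψ R F (q := q₀) (z := z₀)).2
      (.inr (.copyCons (hx b List.mem_cons_self))))
    rw [RunDerives, terminals, List.map_append]
    exact hr.trans (hw.append_left _)

theorem exists_runDerives_erase (x : List (K × Γ)) :
    ∃ w, RunDerives φ ψ R F q₀ z₀ erase w ∧ runTrack φ 0 w = stackWord x ∧
      runTrack φ 1 w = [] := by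
  induction x with
  | nil =>
    exact ⟨blank, derives_of_mem_rules ((mem_rules_runGrammar ..).2 (.inr .eraseNil)),
      by simp [stackWord], by simp⟩
  | cons b x ih =>
    obtain ⟨w, hw, h₀, h₁⟩ := ih
    refine ⟨tile φ (stackWord [b]) [] ++ w, ?_,
      by simp [runTrack_append, h₀, stackWord], by simp [runTrack_append, h₁]⟩
    have hr := derives_of_mem_rules ((mem_rules_runGrammar φ ψ R F (q := q₀) (z := z₀)).2
      (.inr (.eraseCons b)))
    rw [RunDerives, terminals, List.map_append]
    exact hr.trans (hw.append_left _)

/-- Words are built from the halting end of the run backwards. The shuffle `z` must be arbitrary,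
because a move determines the next shuffle from the current one, and the stacks alone do not fix it.
-/
theorem exists_runDerives_run [DecidableEq K] {q : Q} {S : K → List Γ} (h : StackHalts R F q S)
    {z : List (K × Γ)} (hz : stackOf z = S) :
    ∃ w, RunDerives φ ψ R F q₀ z₀ run w ∧
      runTrack φ 0 w = configWord q z ++ runTrack φ 1 w := by
  induction h generalizing z with
  | @final q S hF =>
    obtain ⟨w, hw, h₀, h₁⟩ := exists_runDerives_erase φ ψ (R := R) (F := F) (q₀ := q₀) (z₀ := z₀) z
    refine ⟨tile φ [some (Sum.inl q)] [] ++ (w ++ tile φ [none] []), ?_,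
      by simp [runTrack_append, h₀, h₁, configWord]⟩
    have hr := derives_of_mem_rules ((mem_rules_runGrammar φ ψ R F (q := q₀) (z := z₀)).2
      (.inr (.final hF)))
    rw [RunDerives, terminals, List.map_append, List.map_append]
    exact hr.trans ((hw.append_right _).append_left _)
  | @move q q' S k l r t hR hS _ ih =>
    subst hz
    obtain ⟨x, y, rfl, hx, rfl⟩ := exists_split_of_stackOf_eq l z hS
    obtain ⟨u, hu, hu₀, hu₁⟩ := exists_runDerives_copy φ ψ (R := R) (F := F) (q₀ := q₀) (z₀ := z₀)
      (some k) x fun b hb => by simpa using hx b hb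
    obtain ⟨v, hv, hv₀, hv₁⟩ := exists_runDerives_copy φ ψ (R := R) (F := F) (q₀ := q₀) (z₀ := z₀)
      none y fun b hb => by simp
    obtain ⟨w, hw, h⟩ := ih (stackOf_replace hx l.toList r.toList y)
    refine ⟨tile φ [some (Sum.inl q)] [some (Sum.inl q')] ++ (u ++
      (tile φ (stackWord (l.toList.map (Prod.mk k))) (stackWord (r.toList.map (Prod.mk k))) ++
      (v ++ (tile φ [none] [none] ++ w)))), ?_, ?_⟩
    · have hr := derives_of_mem_rules ((mem_rules_runGrammar φ ψ R F (q := q₀) (z := z₀)).2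
        (.inr (.move hR)))
      simp only [RunDerives, terminals, List.map_append]
      exact hr.trans ((derives_append hu ((derives_append hv (hw.append_left _)).append_left
        _)).append_left _)
    · simp [runTrack_append, hu₀, hu₁, hv₀, hv₁, h, configWord, stackWord_append]

end Completeness

theorem exists_equal_tracks_iff [DecidableEq K] (q₀ : Q) (z₀ : List (K × Γ)) :
    (∃ w ∈ (runGrammar φ ψ R F q₀ z₀).language, track 0 w = track 1 w) ↔
      StackHalts R F q₀ (stackOf z₀) := by
  constructor
  · rintro ⟨w, hw, h⟩
    have hI := mem_of_derives (g := runGrammar φ ψ R F q₀ z₀)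
      (I := fun v => runMeaning φ R F q₀ z₀ (ψ.symm v))
      (fun r hr => runMeaning_closed φ ψ R F q₀ z₀ ((mem_rules_runGrammar φ ψ R F).1 hr)) hw
    have hI' : w ∈ runMeaning φ R F q₀ z₀ start := by
      have e : ψ.symm (runGrammar φ ψ R F q₀ z₀).initial = start := ψ.symm_apply_apply _
      rwa [← e]
    exact hI' (by rw [runTrack, runTrack, h])
  · intro h
    obtain ⟨w, hw, hww⟩ := exists_runDerives_run φ ψ (q₀ := q₀) (z₀ := z₀) h rfl
    refine ⟨tile φ [] (configWord q₀ z₀) ++ w, ?_, ?_⟩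
    · have hr := derives_of_mem_rules ((mem_rules_runGrammar φ ψ R F (q := q₀) (z := z₀)).2
        (.inl rfl))
      rw [ContextFreeGrammar.mem_language_iff, List.map_append]
      exact hr.trans (hw.append_left _)
    -- The numbering `φ` is bijective, so the decoded tracks may be compared instead.
    · apply List.map_injective_iff.2 φ.symm.injective
      change runTrack φ 0 _ = runTrack φ 1 _
      simp [runTrack_append, hww]

/-- The hypergrammar of the runs from a given configuration. -/
noncomputable def runCFHG (R : Q → K → Option Γ → Option Γ → Q → Prop) (F : Q → Prop)
    (a : Quant) (q₀ : Q) (z₀ : List (K × Γ)) : CFHG :=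
  twoVarCFHG a (ψ start) (startRule φ ψ q₀ z₀ :: runRules φ ψ R F)

theorem runCFHG_hyperlanguage_nonempty_iff [DecidableEq K] (a : Quant) (q₀ : Q)
    (z₀ : List (K × Γ)) :
    (runCFHG φ ψ R F a q₀ z₀).hyperlanguage.Nonempty ↔ StackHalts R F q₀ (stackOf z₀) :=
  (twoVarCFHG_hyperlanguage_nonempty_iff _ _ _).trans (exists_equal_tracks_iff φ ψ q₀ z₀)

theorem exists_runDerives (q₀ : Q) (z₀ : List (K × Γ)) (v : RunVar K) :
    ∃ w, RunDerives φ ψ R F q₀ z₀ v w := by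
  have hrun : RunDerives φ ψ R F q₀ z₀ run (tile φ [] [none]) :=
    derives_of_mem_rules ((mem_rules_runGrammar ..).2 (.inr .abort))
  cases v with
  | start =>
    refine ⟨tile φ [] (configWord q₀ z₀) ++ tile φ [] [none], ?_⟩
    have hr := derives_of_mem_rules ((mem_rules_runGrammar φ ψ R F (q := q₀) (z := z₀)).2
      (.inl rfl))
    rw [RunDerives, terminals, List.map_append]
    exact hr.trans (hrun.append_left _)
  | run => exact ⟨_, hrun⟩
  | erase => exact (exists_runDerives_erase φ ψ []).imp fun _ h => h.1
  | copy o => exact (exists_runDerives_copy φ ψ o [] (by simp)).imp fun _ h => h.1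

theorem exists_derives_of_forall_nonterminal {T : Type} {g : ContextFreeGrammar T}
    (h : ∀ v, ∃ w : List T, g.Derives [Symbol.nonterminal v] (w.map Symbol.terminal))
    (u : List (Symbol T g.NT)) : ∃ w : List T, g.Derives u (w.map Symbol.terminal) := by
  induction u with
  | nil => exact ⟨[], .refl _⟩
  | cons a u ih =>
    obtain ⟨w, hw⟩ := ih
    cases a with
    | terminal t => exact ⟨t :: w, hw.append_left [_]⟩
    | nonterminal v =>
      obtain ⟨w', hw'⟩ := h v
      refine ⟨w' ++ w, ?_⟩
      rw [List.map_append]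
      exact derives_append hw' hw

theorem runCFHG_normalized (a : Quant) (q₀ : Q) (z₀ : List (K × Γ)) :
    (runCFHG φ ψ R F a q₀ z₀).Normalized := by
  have hvar : ∀ v : Fin n, ∃ w : List (Fin 2 → Option (Fin s)),
      (runGrammar φ ψ R F q₀ z₀).Derives [Symbol.nonterminal v] (w.map Symbol.terminal) := by
    intro v
    obtain ⟨v, rfl⟩ := ψ.surjective v
    exact exists_runDerives φ ψ q₀ z₀ v
  refine ⟨hvar, fun r _ => exists_derives_of_forall_nonterminal
    (g := runGrammar φ ψ R F q₀ z₀) hvar r.output, ?_⟩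
  intro r hr h
  rcases List.mem_cons.1 hr with rfl | hr
  · rfl
  -- Every right-hand side contains a letter or a variable; copying and erasing end with the all-`#`
  -- letter of `blank` instead of `ε`.
  · rcases (mem_runRules φ ψ R F).1 hr with h' | h' | _ | _ | h' | _ | _ <;>
      simp [moveRule, finalRule, abortRule, copyNilRule, copyConsRule, eraseNilRule,
        eraseConsRule, terminals, tile, blank, stackWord] at h

end Runs

/-! ### `TM2` programs as stack machines -/

open Turing TM2

section StackMachine

variable {K Γ Λ σ : Type}

/-- The moves of a stack machine that executes the statements of a `TM2` program, where each stack
has the bottom letter `none`. -/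
inductive StmtMove (M : Λ → Stmt (fun _ : K => Γ) Λ σ) :
    Stmt (fun _ : K => Γ) Λ σ → σ → K → Option (Option Γ) → Option (Option Γ) →
      Stmt (fun _ : K => Γ) Λ σ → σ → Prop
  | push (k f q v) : StmtMove M (.push k f q) v k none (some (some (f v))) q v
  | peek (k f q v) (a : Option Γ) : StmtMove M (.peek k f q) v k (some a) (some a) q (f v a)
  | pop (k f q v a) : StmtMove M (.pop k f q) v k (some (some a)) none q (f v (some a))
  | popBottom (k f q v) : StmtMove M (.pop k f q) v k (some none) (some none) q (f v none)
  | load (k a q v) : StmtMove M (.load a q) v k none none q (a v)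
  | branch (k f q₁ q₂ v) :
      StmtMove M (.branch f q₁ q₂) v k none none (cond (f v) q₁ q₂) v
  | goto (k l v) : StmtMove M (.goto l) v k none none (M (l v)) v

/-- The states of the stack machine. -/
abbrev StmtState (M : Λ → Stmt (fun _ : K => Γ) Λ σ) (P : Finset Λ) : Type :=
  {q // some q ∈ stmts M P} × σ

noncomputable instance (M : Λ → Stmt (fun _ : K => Γ) Λ σ) (P : Finset Λ) [Fintype σ] :
    Fintype (StmtState M P) :=
  have : Finite {q // some q ∈ stmts M P} :=
    ((stmts M P).finite_toSet.preimage (Option.some_injective _).injOn).to_subtype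
  have := Fintype.ofFinite {q // some q ∈ stmts M P}
  inferInstance

variable (M : Λ → Stmt (fun _ : K => Γ) Λ σ) (P : Finset Λ)

/-- The moves between the states of the stack machine. -/
def StateMove (p : StmtState M P) (k : K) (l r : Option (Option Γ)) (p' : StmtState M P) : Prop :=
  StmtMove M p.1.1 p.2 k l r p'.1.1 p'.2

/-- The final states of the stack machine. -/
def StateFinal (p : StmtState M P) : Prop := p.1.1 = Stmt.halt

/-- Stacks with their bottom letters. -/
def withBottom (S : K → List Γ) (k : K) : List (Option Γ) := (S k).map some ++ [none]

theorem some_mem_stmts {M : Λ → Stmt (fun _ : K => Γ) Λ σ} {P : Finset Λ} {l : Λ}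
    (hl : l ∈ P) : some (M l) ∈ stmts M P := by
  simp only [stmts, Finset.some_mem_insertNone, Finset.mem_biUnion]
  exact ⟨l, hl, stmts₁_self⟩

variable [DecidableEq K]

theorem update_withBottom (S : K → List Γ) (k : K) (t : List Γ) :
    Function.update (withBottom S) k (t.map some ++ [none]) =
      withBottom (Function.update S k t) := by
  funext k'
  by_cases h : k' = k
  · subst h
    simp [withBottom]
  · simp [withBottom, h]

/-- Acceptance from a configuration between two steps of the program. -/
def CfgHalts (c : Cfg (fun _ : K => Γ) Λ σ) : Prop :=
  ∀ l, c.l = some l → ∀ h, StackHalts (StateMove M P) (StateFinal M P) (⟨M l, h⟩, c.var)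
    (withBottom c.stk)

variable {M P}

theorem stackHalts_of_stmtMove {q q' : Stmt (fun _ : K => Γ) Λ σ} {v v' : σ} {k : K}
    {l r : Option (Option Γ)} {t : List (Option Γ)} {S S' : K → List Γ}
    (h : StmtMove M q v k l r q' v') (hq : some q ∈ stmts M P) (hq' : some q' ∈ stmts M P)
    (hS : withBottom S k = l.toList ++ t)
    (hS' : Function.update (withBottom S) k (r.toList ++ t) = withBottom S')
    (h' : StackHalts (StateMove M P) (StateFinal M P) (⟨q', hq'⟩, v') (withBottom S')) :
    StackHalts (StateMove M P) (StateFinal M P) (⟨q, hq⟩, v) (withBottom S) :=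
  .move (show StateMove M P (⟨q, hq⟩, v) k l r (⟨q', hq'⟩, v') from h) hS (hS' ▸ h')

theorem eval_some_label (l : Λ) (v : σ) (S : K → List Γ) :
    StateTransition.eval (TM2.step M) ⟨some l, v, S⟩ =
      StateTransition.eval (TM2.step M) (stepAux (M l) v S) :=
  StateTransition.reaches_eval (f := TM2.step M) (.single rfl)

/-- A step of `TM2` executes a whole statement up to the next `goto` or `halt`, whereas the stack
machine makes one move per instruction; hence the induction on the statement. At a `goto`, the
support condition keeps the target label in `P`, and the hypothesis on the resulting configuration
takes over. -/
theorem stackHalts_of_cfgHalts [Nonempty K] (hP : ∀ l ∈ P, SupportsStmt P (M l))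
    (q : Stmt (fun _ : K => Γ) Λ σ) (v : σ)
    (S : K → List Γ) (hq : some q ∈ stmts M P) (h : CfgHalts M P (stepAux q v S)) :
    StackHalts (StateMove M P) (StateFinal M P) (⟨q, hq⟩, v) (withBottom S) := by
  have hsup : ∀ {q}, some q ∈ stmts M P → SupportsStmt P q := by
    intro q hq
    simp only [stmts, Finset.some_mem_insertNone, Finset.mem_biUnion] at hq
    obtain ⟨l, hl, hq⟩ := hq
    exact stmts₁_supportsStmt_mono hq (hP l hl)
  -- A move must name a stack even if it changes none; `k₀` serves for `load`, `branch` and `goto`.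
  obtain ⟨k₀⟩ := ‹Nonempty K›
  induction q generalizing v S with
  | push k f q ih =>
    have hq' : some q ∈ stmts M P := stmts_trans (by simp [stmts₁, stmts₁_self]) hq
    exact stackHalts_of_stmtMove (.push k f q v) hq hq' (t := withBottom S k) rfl
      (update_withBottom S k (f v :: S k)) (ih _ _ hq' h)
  | peek k f q ih =>
    have hq' : some q ∈ stmts M P := stmts_trans (by simp [stmts₁, stmts₁_self]) hq
    obtain ⟨t, ht⟩ : ∃ t, withBottom S k = (S k).head? :: t := by
      cases hS : S k <;> simp [withBottom, hS]
    exact stackHalts_of_stmtMove (.peek k f q v (S k).head?) hq hq' ht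
      (by simp [← ht]) (ih _ _ hq' h)
  | pop k f q ih =>
    have hq' : some q ∈ stmts M P := stmts_trans (by simp [stmts₁, stmts₁_self]) hq
    have h' := ih (f v (S k).head?) (Function.update S k (S k).tail) hq' h
    cases hS : S k with
    | nil =>
      rw [hS] at h'
      exact stackHalts_of_stmtMove (.popBottom k f q v) hq hq' (t := [])
        (by simp [withBottom, hS]) (update_withBottom S k []) h'
    | cons a t =>
      rw [hS] at h'
      exact stackHalts_of_stmtMove (.pop k f q v a) hq hq' (t := t.map some ++ [none])
        (by simp [withBottom, hS]) (update_withBottom S k t) h'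
  | load a q ih =>
    have hq' : some q ∈ stmts M P := stmts_trans (by simp [stmts₁, stmts₁_self]) hq
    exact stackHalts_of_stmtMove (.load k₀ a q v) hq hq' (t := withBottom S k₀) rfl
      (by simp) (ih _ _ hq' h)
  | branch f q₁ q₂ ih₁ ih₂ =>
    have hm := StmtMove.branch (M := M) k₀ f q₁ q₂ v
    rw [stepAux] at h
    cases hf : f v <;> rw [hf] at hm h
    · have hq' : some q₂ ∈ stmts M P := stmts_trans (by simp [stmts₁, stmts₁_self]) hq
      exact stackHalts_of_stmtMove hm hq hq' (t := withBottom S k₀) rfl (by simp) (ih₂ _ _ hq' h)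
    · have hq' : some q₁ ∈ stmts M P := stmts_trans (by simp [stmts₁, stmts₁_self]) hq
      exact stackHalts_of_stmtMove hm hq hq' (t := withBottom S k₀) rfl (by simp) (ih₁ _ _ hq' h)
  | goto l =>
    have hq' : some (M (l v)) ∈ stmts M P := some_mem_stmts (hsup hq v)
    exact stackHalts_of_stmtMove (.goto k₀ l v) hq hq' (t := withBottom S k₀) rfl
      (by simp) (h (l v) rfl hq')
  | halt => exact .final rfl

/-- Nondeterminism does no harm: a guessed top letter is checked against the stack, and the stack
named by an idle move is irrelevant. Each move preserves the result of `stepAux`, except `goto`,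
which starts the next step of the program and so preserves `eval`. -/
theorem eval_dom_of_stackHalts {p : StmtState M P} {T : K → List (Option Γ)}
    (h : StackHalts (StateMove M P) (StateFinal M P) p T) {S : K → List Γ} (hS : T = withBottom S) :
    (StateTransition.eval (TM2.step M) (stepAux p.1.1 p.2 S)).Dom := by
  induction h generalizing S with
  | @final p T hF =>
    rw [hF]
    exact Part.dom_iff_mem.2 ⟨_, StateTransition.mem_eval.2 ⟨.refl, rfl⟩⟩
  | @move p p' T k l r t hR hT _ ih =>
    subst hS
    obtain ⟨⟨q, hq⟩, v⟩ := p
    obtain ⟨⟨q', hq'⟩, v'⟩ := p'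
    simp only [StateMove] at hR ih ⊢
    cases hR with
    | push k f q v =>
      exact ih (by rw [← update_withBottom, ← (show withBottom S k = t from hT)]; rfl)
    | peek k f q v a =>
      have ha : (S k).head? = a := by
        cases hS : S k <;> simp_all [withBottom]
      rw [stepAux, ha]
      exact ih (by rw [← hT]; simp)
    | pop k f q v a =>
      cases hS : S k with
      | nil => simp [withBottom, hS] at hT
      | cons b u =>
        simp only [withBottom, hS, List.map_cons, List.cons_append, Option.toList_some,
          List.nil_append, List.cons.injEq, Option.some.injEq] at hT
        obtain ⟨rfl, rfl⟩ := hT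
        rw [stepAux, hS]
        exact ih (by rw [← update_withBottom]; rfl)
    | popBottom k f q v =>
      cases hS : S k with
      | cons b u => simp [withBottom, hS] at hT
      | nil =>
        rw [stepAux, hS]
        refine ih ?_
        rw [← update_withBottom, ← hT]
        simp [withBottom, hS]
    | load k a q v => exact ih (by rw [← hT]; simp)
    | branch k f q₁ q₂ v =>
      have := ih (S := S) (by rw [← hT]; simp)
      cases hf : f v <;> simpa [hf] using this
    | goto k l v =>
      have := ih (S := S) (by rw [← hT]; simp)
      rwa [stepAux, eval_some_label]

theorem stackHalts_iff_eval_dom [Nonempty K] (hP : ∀ l ∈ P, SupportsStmt P (M l)) {l : Λ}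
    (hl : some (M l) ∈ stmts M P) (v : σ) (S : K → List Γ) :
    StackHalts (StateMove M P) (StateFinal M P) (⟨M l, hl⟩, v) (withBottom S) ↔
      (StateTransition.eval (TM2.step M) ⟨some l, v, S⟩).Dom := by
  constructor
  · intro h
    rw [eval_some_label]
    exact eval_dom_of_stackHalts h rfl
  · intro h
    obtain ⟨b, hb⟩ := Part.dom_iff_mem.1 h
    obtain ⟨hb, hb'⟩ := StateTransition.mem_eval.1 hb
    -- Induction backwards from the halting configuration `b`, which has no label and satisfies
    -- `CfgHalts` vacuously.
    suffices key : ∀ c, StateTransition.Reaches (TM2.step M) c b → CfgHalts M P c from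
      key _ hb l rfl hl
    intro c hc
    induction hc using Relation.ReflTransGen.head_induction_on with
    | refl =>
      intro l' hl'
      obtain ⟨_ | l, v, S⟩ := b
      · cases hl'
      · cases hb'
    | head h _ ih =>
      rename_i c c' _
      obtain ⟨_ | l, v, S⟩ := c
      · cases h
      · cases h
        rintro _ ⟨⟩ hM
        exact stackHalts_of_cfgHalts hP _ _ _ hM ih

end StackMachine

/-! ### The reduction from the halting problem -/

open Turing PartrecToTM2

/-- `trNat` writes binary digits with the least significant first. Powers of two thus give initial
stacks that depend on `m` only through the length of a constant block. -/
theorem trNat_two_pow (m : ℕ) : trNat (2 ^ m) = List.replicate m Γ'.bit0 ++ [Γ'.bit1] := by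
  have key : ∃ p : PosNum, ((2 ^ m : ℕ) : Num) = Num.pos p ∧
      trPosNum p = List.replicate m Γ'.bit0 ++ [Γ'.bit1] := by
    induction m with
    | zero => exact ⟨1, rfl, rfl⟩
    | succ m ih =>
      obtain ⟨p, hp, h⟩ := ih
      refine ⟨p.bit0, ?_, by simp [trPosNum, h, List.replicate_succ]⟩
      rw [pow_succ, mul_two, Nat.cast_add, hp, Num.bit0_of_bit0]
      rfl
  obtain ⟨p, hp, h⟩ := key
  rw [trNat, hp, trNum, h]

theorem primrec_two_pow : Primrec fun m : ℕ => 2 ^ m := by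
  refine (Primrec.nat_rec₁ (f := fun _ y => 2 * y) 1
    (Primrec.nat_mul.comp (Primrec.const 2) Primrec.snd)).of_eq fun m => ?_
  induction m with
  | zero => rfl
  | succ m ih => rw [pow_succ, mul_comm, ← ih]

/-- The halting problem is the domain problem of a fixed code on powers of two. -/
theorem exists_code_eval_two_pow_dom :
    ∃ c : ToPartrec.Code, ∀ m : ℕ, (c.eval [2 ^ m]).Dom ↔
      (Nat.Partrec.Code.eval (Denumerable.ofNat Nat.Partrec.Code m) 0).Dom := by
  -- The search recovers the exponent of a power of two and diverges on all other inputs.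
  let f : ℕ →. ℕ := fun k => (Nat.rfind fun m => Part.some (decide (2 ^ m = k))).bind fun m =>
    Nat.Partrec.Code.eval (Denumerable.ofNat Nat.Partrec.Code m) 0
  have hf : Partrec f := by
    refine Partrec.bind (Partrec.rfind ?_) ?_
    · refine Computable.partrec (Primrec.to_comp ?_)
      exact PrimrecPred.decide
        (Primrec.eq.comp (primrec_two_pow.comp Primrec.snd) Primrec.fst)
    · exact Nat.Partrec.Code.eval_part.comp ((Computable.ofNat _).comp Computable.snd)
        (Computable.const 0)
  obtain ⟨c, hc⟩ := ToPartrec.Code.exists_code (Nat.Partrec'.part_iff₁.2 hf)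
  refine ⟨c, fun m => ?_⟩
  have h := hc ⟨[2 ^ m], rfl⟩
  have hr : (Nat.rfind fun m' => Part.some (decide (2 ^ m' = 2 ^ m))) = Part.some m := by
    refine Part.eq_some_iff.2 (Nat.mem_rfind.2 ⟨by simp, fun {m'} hm' => ?_⟩)
    simpa using hm'.ne
  have hfm : f (2 ^ m) = Nat.Partrec.Code.eval (Denumerable.ofNat Nat.Partrec.Code m) 0 := by
    simp only [f, hr, Part.bind_some]
  change c.eval [2 ^ m] = pure <$> f (2 ^ m) at h
  rw [h, hfm]
  rfl

instance : Fintype K' :=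
  ⟨{.main, .rev, .aux, .stack}, by rintro (_ | _ | _ | _) <;> simp⟩

/-- A shuffle of the initial stacks, with bottom letters, for the input `2 ^ m`. -/
def initialShuffle (m : ℕ) : List (K' × Option Γ') :=
  List.replicate m (K'.main, some Γ'.bit0) ++
    [(K'.main, some Γ'.bit1), (K'.main, some Γ'.cons), (K'.main, none), (K'.rev, none),
      (K'.aux, none), (K'.stack, none)]

theorem stackOf_initialShuffle (m : ℕ) :
    stackOf (initialShuffle m) = withBottom (K'.elim (trList [2 ^ m]) [] [] []) := by
  funext k
  simp only [withBottom, trList, trNat_two_pow]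
  cases k <;>
    simp [initialShuffle, stackOf, List.filter_append, K'.elim]

theorem primrec_append_replicate_append {α : Type} [Primcodable α] (x y : List α) (a : α) :
    Primrec fun m : ℕ => x ++ (List.replicate m a ++ y) := by
  have h : Primrec fun m : ℕ => List.replicate m a :=
    (Primrec.list_map Primrec.list_range (Primrec.const a).to₂).of_eq fun m => by
      simp
  exact Primrec.list_append.comp (Primrec.const x)
    (Primrec.list_append.comp h (Primrec.const y))

/-- The list `runRules` is chosen classically, but it does not depend on `m` and enters as a
constant. The start rule is a fixed prefix, a letter repeated `m` times and a fixed suffix. -/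
theorem computable_encode_runCFHG {Q : Type} [Fintype Q] {s n : ℕ}
    (φ : RunLetter Q K' (Option Γ') ≃ Fin s) (ψ : RunVar K' ≃ Fin n)
    (R : Q → K' → Option (Option Γ') → Option (Option Γ') → Q → Prop) (F : Q → Prop)
    (a : Quant) (q : Q) :
    Computable fun m => (runCFHG φ ψ R F a q (initialShuffle m)).encode := by
  let e : RunLetter Q K' (Option Γ') → List (Option ℕ) ⊕ ℕ := fun b =>
    CFHG.encodeSymbol (n := n) (Symbol.terminal ![none, some (φ b)])
  have h : ∀ m, (runCFHG φ ψ R F a q (initialShuffle m)).encode =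
      (s, n, (ψ .start).val, [CFHG.encodeQuant a, true],
        ((ψ .start).val,
          [e (some (Sum.inl q))] ++ (List.replicate m (e (some (Sum.inr (.main, some .bit0)))) ++
          ((stackWord [(K'.main, some Γ'.bit1), (K'.main, some Γ'.cons), (K'.main, none),
            (K'.rev, none), (K'.aux, none), (K'.stack, none)]).map e ++ [e none] ++
            [Sum.inr (ψ .run).val]))) ::
        (runRules φ ψ R F).map CFHG.encodeRule) := by
    intro m
    simp only [CFHG.encode, runCFHG, twoVarCFHG, List.map_cons]
    refine congrArg _ (congrArg _ (congrArg _ ?_))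
    refine Prod.ext rfl ?_
    refine congrArg (· :: _) (Prod.ext rfl ?_)
    simp [CFHG.encodeRule, startRule, configWord, initialShuffle, stackWord, tile, e,
      CFHG.encodeSymbol]
  refine Primrec.to_comp (Primrec.of_eq ?_ fun m => (h m).symm)
  exact Primrec.pair (.const _) (Primrec.pair (.const _) (Primrec.pair (.const _)
    (Primrec.pair (.const _) (Primrec.list_cons.comp
      (Primrec.pair (.const _) (primrec_append_replicate_append ..)) (.const _)))))

theorem exists_computable_reduction (a : Quant) :
    ∃ G : ℕ → CFHG, Computable (fun m => (G m).encode) ∧ (∀ m, (G m).Normalized) ∧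
      (∀ m, ∃ (s n : ℕ) (v : Fin n)
        (r : List (ContextFreeRule (Fin 2 → Option (Fin s)) (Fin n))), G m = twoVarCFHG a v r) ∧
      ∀ m, (G m).hyperlanguage.Nonempty ↔
        (Nat.Partrec.Code.eval (Denumerable.ofNat Nat.Partrec.Code m) 0).Dom := by
  obtain ⟨c, hc⟩ := exists_code_eval_two_pow_dom
  -- The label type `Λ'` is infinite; this finite set of labels, closed under jumps, makes the
  -- states and hence the grammar finite.
  let P := codeSupp c Cont'.halt
  have hP := tr_supports c Cont'.halt
  let M : Λ' → TM2.Stmt (fun _ : K' => Γ') Λ' (Option Γ') := tr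
  have hl : some (M (trNormal c Cont'.halt)) ∈ TM2.stmts M P := some_mem_stmts hP.1
  let φ := Fintype.equivFin (RunLetter (StmtState M P) K' (Option Γ'))
  let ψ := Fintype.equivFin (RunVar K')
  refine ⟨fun m => runCFHG φ ψ (StateMove M P) (StateFinal M P) a (⟨_, hl⟩, none)
    (initialShuffle m), computable_encode_runCFHG .., fun m => runCFHG_normalized ..,
    fun m => ⟨_, _, _, _, rfl⟩, fun m => ?_⟩
  rw [runCFHG_hyperlanguage_nonempty_iff, stackOf_initialShuffle, stackHalts_iff_eval_dom hP.2,
    ← hc m]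
  -- By correctness of the compilation, the program evaluates to the image of `c.eval [2 ^ m]` under
  -- a total map, so the domains agree.
  have he := tr_eval c [2 ^ m]
  change StateTransition.eval (TM2.step M) ⟨some (trNormal c Cont'.halt), none, _⟩ = _ at he
  rw [he]
  rfl

theorem undecidable_of_reduction {C : CFHG → Prop} {G : ℕ → CFHG}
    (hG : Computable fun m => (G m).encode) (hC : ∀ m, C (G m))
    (h : ∀ m, (G m).hyperlanguage.Nonempty ↔
      (Nat.Partrec.Code.eval (Denumerable.ofNat Nat.Partrec.Code m) 0).Dom) :
    CFHG.Undecidable C (fun G => G.hyperlanguage = ∅) ∧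
      CFHG.Undecidable C (fun G => G.hyperlanguage.Nonempty) := by
  have key : CFHG.Undecidable C (fun G => G.hyperlanguage.Nonempty) := by
    rintro ⟨f, hf, hfC⟩
    refine ComputablePred.halting_problem 0 (ComputablePred.computable_iff.2
      ⟨fun c => f (G (Encodable.encode c)).encode, hf.comp (hG.comp Computable.encode), ?_⟩)
    funext c
    have hc := (hfC _ (hC (Encodable.encode c))).trans (h _)
    rw [Denumerable.ofNat_encode] at hc
    exact propext hc.symm
  refine ⟨?_, key⟩
  rintro ⟨f, hf, hfC⟩
  refine key ⟨fun x => !f x, Primrec.not.to_comp.comp hf, fun G hG => ?_⟩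
  refine Iff.trans ?_ Set.nonempty_iff_ne_empty.symm
  refine Iff.trans ?_ (not_congr (hfC G hG))
  simp

end HyperGrammar

theorem mainTheorem3 :
    (HyperGrammar.CFHG.Undecidable (fun G => G.Normalized ∧ G.IsForallStar)
        (fun G => G.hyperlanguage = ∅) ∧
      HyperGrammar.CFHG.Undecidable (fun G => G.Normalized ∧ G.IsForallStar)
        (fun G => G.hyperlanguage.Nonempty)) ∧
    (HyperGrammar.CFHG.Undecidable (fun G => G.Normalized ∧ G.IsExistsForall)
        (fun G => G.hyperlanguage = ∅) ∧
      HyperGrammar.CFHG.Undecidable (fun G => G.Normalized ∧ G.IsExistsForall)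
        (fun G => G.hyperlanguage.Nonempty)) := by
  constructor
  · obtain ⟨G, hG, hn, htwo, h⟩ := HyperGrammar.exists_computable_reduction .all
    refine HyperGrammar.undecidable_of_reduction hG (fun m => ⟨hn m, ?_⟩) h
    obtain ⟨s, n, v, r, e⟩ := htwo m
    rw [e]
    intro i
    change Fin 2 at i
    fin_cases i <;> rfl
  · obtain ⟨G, hG, hn, htwo, h⟩ := HyperGrammar.exists_computable_reduction .ex
    refine HyperGrammar.undecidable_of_reduction hG (fun m => ⟨hn m, ?_⟩) h
    obtain ⟨s, n, v, r, e⟩ := htwo m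
    rw [e]
    rfl
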